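/- **Setting.** Let $\Omega\subset\mathbb R^d$ carry a metric $\mathsf d$ that induces its usual topology, and write $B(x,\rho)=\{y\in\Omega:\mathsf d(x,y)<\rho\}$. Let $\mathsf m$ be a regular Borel measure on $\Omega$ (such as Lebesgue measure on a solid domain or surface measure on a surface) that is doubling, $\mathsf m(B(x,2\rho))\le C\,\mathsf m(B(x,\rho))$ for all $x\in\Omega$, $\rho>0$, and satisfies $\inf_{x\in\Omega}\mathsf m(B(x,\varepsilon))>0$ for every $\varepsilon>0$. For a nonnegative $\mathsf m$-integrable function $\mathsf w$ put $\mathsf w(E)=\int_E\mathsf w\,d\mathsf m$; $\mathsf w$ is a *doubling weight* if there is $L>0$ with $\mathsf w(B(x,2\rho))\le L\,\mathsf w(B(x,\rho))$ for all $x\in\Omega$, $\rho>0$. Let $\|\cdot\|_{p,\mathsf w}$ be the norm of $L^p(\Omega,\mathsf w\,d\mathsf m)$ if $1\le p<\infty$, and the uniform norm on $\Omega$ if $p=\infty$. Let $\Pi(\Omega)$ be the space of polynomials restricted to $\Omega$, and $\Pi_n(\Omega)$ the subspace of those of degree at most $n$. Let $\varpi$ be a doubling weight with $\int_\Omega\varpi\,d\mathsf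 m=1$. Let $\mathcal V_k$ be the space of those $Y\in\Pi_k(\Omega)$ with $\int_\Omega Yg\,\varpi\,d\mathsf m=0$ for all $g\in\Pi_j(\Omega)$, $j<k$; let $P_k(x,y)$ be its reproducing kernel with respect to $\langle f,g\rangle_\varpi=\int_\Omega fg\,\varpi\,d\mathsf m$, and $\operatorname{proj}_kf(x)=\int_\Omega f(y)P_k(x,y)\varpi(y)\,d\mathsf m(y)$. Let $\mathfrak D_\varpi$ be a linear operator on $\Pi(\Omega)$ with $\mathfrak D_\varpi Y=-\mu(k)Y$ for all $Y\in\mathcal V_k$, $k\ge0$, where $\mu$ is a real quadratic polynomial with $\mu(k)\ge0$ for $k=0,1,2,\dots$; for $f\in\Pi(\Omega)$ and $r>0$ put $$(-\mathfrak D_\varpi)^{r/2}f=\sum_{k\ge0}\mu(k)^{r/2}\operatorname{proj}_kf .$$ Let $\widehat a$ be a cut-off function: nonnegative and $C^\infty$ on $[0,\infty)$, $\widehat a=1$ on $[0,1]$, $\widehat a=0$ on $(2,\infty)$. For $n\ge1$ put $$L_n(x,y)=\sum_{k\ge0}\widehat a(k/n)P_k(x,y),\qquad L_n^{(r)}(x,y)=\sum_{k\ge0}\widehat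 a(k/n)\,\mu(k)^{r/2}P_k(x,y).$$ **Assertions.** All constants $c_\kappa,c,\dots$ are positive and independent of $n\ge1$ and of the points of $\Omega$. 1. For every $\kappa>0$ there is $c_\kappa$ with $$|L_n(x,y)|\le \frac{c_\kappa}{\sqrt{\varpi(B(x,\frac1n))}\sqrt{\varpi(B(y,\frac1n))}\,(1+n\mathsf d(x,y))^{\kappa}}.$$ 2. There is $\delta_0\in(0,1)$ such that for every $\kappa>0$ there is $c_\kappa$ with, whenever $0<\delta\le\delta_0$ and $x_1\in B(x_2,\frac\delta n)$, $$|L_n(x_1,y)-L_n(x_2,y)|\le \frac{c_\kappa\,n\mathsf d(x_1,x_2)}{\sqrt{\varpi(B(x_1,\frac1n))}\sqrt{\varpi(B(x_2,\frac1n))}\,(1+n\mathsf d(x_2,y))^{\kappa}}.$$ 3. For all sufficiently large $\kappa>0$ there is $c$ with $$\int_\Omega \frac{\varpi(y)}{\varpi(B(y,\frac1n))(1+n\mathsf d(x,y))^{\kappa}}\,d\mathsf m(y)\le c .$$ 4. $\Omega$ is compact, and for every $\gamma>1$ there are $\delta,c_\gamma,c_1,c_2>0$ and a positive integer $s$ such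 that for all $n\ge1$ there are polynomials $T_x\in\Pi_n(\Omega)$ ($x\in\Omega$) and $q_n\in\Pi(\Omega)$ with: $T_x(x)=1$; $T_x\ge\delta$ on $B(x,\frac1n)$; $0\le T_x(y)\le c_\gamma(1+n\mathsf d(x,y))^{-\gamma}$ for $y\in\Omega$; $x\mapsto q_n(x)T_x(y)$ belongs to $\Pi_{sn}(\Omega)$ for each $y$; and $c_1\le q_n\le c_2$ on $\Omega$. 5. (of order $r$) For every $\kappa>0$ there is $c_\kappa$ with $$|L^{(r)}_n(x,y)|\le \frac{c_\kappa\,n^r}{\sqrt{\varpi(B(x,\frac1n))}\sqrt{\varpi(B(y,\frac1n))}}\,(1+n\mathsf d(x,y))^{-\kappa}.$$ **Theorem.** Let $r>0$ and suppose that, for some cut-off function $\widehat a$ as above, $\varpi$ admits Assertions 1–4 and Assertion 5 of order $r$. Let $\mathsf w$ be a doubling weight on $\Omega$ and $1\le p\le\infty$. Then there is a constant $c>0$ such that for all $n\ge1$ and all $f\in\Pi_n(\Omega)$, $$\|(-\mathfrak D_\varpi)^{r/2}f\|_{p,\mathsf w}\le c\,n^r\,\|f\|_{p,\mathsf w}.$$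 -/

import Mathlib

open MeasureTheory
open scoped ENNReal

noncomputable section

namespace ConicBernstein

variable {d : ℕ} {Ω : Type*}

/-! ### Polynomials on the domain

The domain is a metric space `Ω` (its metric is the intrinsic distance) together with a topological
embedding `ι` into `ℝ^d`.  The reference measure `m` is the Lebesgue measure of a solid domain, or the
surface measure of a surface; nothing else about it is used than that it is doubling. -/

/-- Restriction of a polynomial in `d` real variables to the domain. -/
def restrictPoly (ι : Ω → EuclideanSpace ℝ (Fin d)) : MvPolynomial (Fin d) ℝ →ₗ[ℝ] (Ω → ℝ) :=
  LinearMap.pi fun x => (MvPolynomial.aeval (fun i => ι x i) : MvPolynomial (Fin d) ℝ →ₐ[ℝ] ℝ).toLinearMap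

/-- `Π(Ω)`: all polynomials, restricted to the domain. -/
def polys (ι : Ω → EuclideanSpace ℝ (Fin d)) : Submodule ℝ (Ω → ℝ) :=
  LinearMap.range (restrictPoly ι)

/-- `Π_n(Ω)`: polynomials of total degree at most `n`, restricted to the domain. -/
def polysDeg (ι : Ω → EuclideanSpace ℝ (Fin d)) (n : ℕ) : Submodule ℝ (Ω → ℝ) :=
  (MvPolynomial.restrictTotalDegree (Fin d) ℝ n).map (restrictPoly ι)

section Weights

variable [MetricSpace Ω] [MeasurableSpace Ω]

/-- The standing assumptions on the reference measure `m` of the homogeneous space `(Ω, m, dist)`: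
it is regular and doubling, and balls of a given radius have measure bounded below. -/
structure IsHomogeneous (m : Measure Ω) : Prop where
  regular : m.Regular
  doubling : ∃ c : ℝ, 0 < c ∧ ∀ (x : Ω) (ρ : ℝ), 0 < ρ →
    m (Metric.ball x (2 * ρ)) ≤ ENNReal.ofReal c * m (Metric.ball x ρ)
  ball_lower : ∀ ε : ℝ, 0 < ε → ∃ c : ℝ, 0 < c ∧ ∀ x : Ω, ENNReal.ofReal c ≤ m (Metric.ball x ε)

/-- `w(E) = ∫_E w dm`. -/
def mass (m : Measure Ω) (w : Ω → ℝ) (E : Set Ω) : ℝ := ∫ x in E, w x ∂m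

/-- Doubling weights: nonnegative, integrable, `w(B(x,2ρ)) ≤ L w(B(x,ρ))`. -/
structure IsDoublingWeight (m : Measure Ω) (w : Ω → ℝ) : Prop where
  nonneg : ∀ x, 0 ≤ w x
  integrable : Integrable w m
  doubling : ∃ L : ℝ, 0 < L ∧ ∀ (x : Ω) (ρ : ℝ), 0 < ρ →
    mass m w (Metric.ball x (2 * ρ)) ≤ L * mass m w (Metric.ball x ρ)

end Weights

section OrthogonalPolynomials

variable [MeasurableSpace Ω]

/-- The norm of `L^p(Ω, w)` for `p < ∞`, and the uniform norm for `p = ∞`. -/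
def wNorm (m : Measure Ω) (w : Ω → ℝ) (p : ℝ≥0∞) (f : Ω → ℝ) : ℝ≥0∞ :=
  open Classical in
  if p = ⊤ then ⨆ x, ‖f x‖ₑ
  else eLpNorm f p (m.withDensity fun x => ENNReal.ofReal (w x))

/-- `⟨f, g⟩_ϖ = ∫ f g ϖ dm`. -/
def ip (m : Measure Ω) (ϖ : Ω → ℝ) (f g : Ω → ℝ) : ℝ := ∫ y, f y * g y * ϖ y ∂m

/-- `V_k(Ω, ϖ)`: polynomials of degree at most `k` that are orthogonal to all polynomials of lower
degree. -/
def orthoPolys (ι : Ω → EuclideanSpace ℝ (Fin d)) (m : Measure Ω) (ϖ : Ω → ℝ) (k : ℕ) :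
    Set (Ω → ℝ) :=
  {Y | Y ∈ polysDeg ι k ∧ ∀ j < k, ∀ g ∈ polysDeg ι j, ip m ϖ g Y = 0}

/-- The reproducing kernel `P_k(ϖ; x, ·)`: the element of `V_k(Ω, ϖ)` that represents the
evaluation at `x` on `V_k(Ω, ϖ)`.  (It exists and is unique when `⟨·,·⟩_ϖ` is an inner product on
polynomials; the value `0` is used otherwise.) -/
def repKernel (ι : Ω → EuclideanSpace ℝ (Fin d)) (m : Measure Ω) (ϖ : Ω → ℝ) (k : ℕ) (x : Ω) :
    Ω → ℝ :=
  open Classical in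
  if h : ∃ q ∈ orthoPolys ι m ϖ k, ∀ f ∈ orthoPolys ι m ϖ k, ip m ϖ f q = f x
  then h.choose else 0

/-- The orthogonal projection `proj_k(ϖ; f, x) = ∫ f(y) P_k(ϖ; x, y) ϖ(y) dm(y)`. -/
def proj (ι : Ω → EuclideanSpace ℝ (Fin d)) (m : Measure Ω) (ϖ : Ω → ℝ) (k : ℕ) (f : Ω → ℝ)
    (x : Ω) : ℝ :=
  ip m ϖ f (repKernel ι m ϖ k x)

/-- A cut-off function that reproduces low degrees: nonnegative and smooth on `[0, ∞)`, equal to `1`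
on `[0, 1]`, vanishing on `(2, ∞)`.  Only its values on `[0, ∞)` matter. -/
structure IsCutoff (a : ℝ → ℝ) : Prop where
  smooth : ContDiffOn ℝ ((⊤ : ℕ∞) : WithTop ℕ∞) a (Set.Ici 0)
  nonneg : ∀ t, 0 ≤ t → 0 ≤ a t
  eq_one : ∀ t ∈ Set.Icc (0 : ℝ) 1, a t = 1
  eq_zero : ∀ t, 2 < t → a t = 0

/-- `L_n(ϖ; x, y) = ∑_k a(k/n) P_k(ϖ; x, y)`; the terms with `k > 2n` vanish for a cut-off `a`. -/
def locKernel (ι : Ω → EuclideanSpace ℝ (Fin d)) (m : Measure Ω) (ϖ : Ω → ℝ) (a : ℝ → ℝ) (n : ℕ)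
    (x y : Ω) : ℝ :=
  ∑ k ∈ Finset.range (2 * n + 1), a ((k : ℝ) / n) * repKernel ι m ϖ k x y

/-- A linear operator `𝔇_ϖ` on polynomials that has the orthogonal polynomials as eigenfunctions,
`𝔇_ϖ Y = -μ(k) Y` for `Y ∈ V_k(Ω, ϖ)`, where `μ` is a quadratic polynomial, nonnegative on `ℕ`.
(In the applications it is a second order differential or differential-difference operator.) -/
structure EigenOperator (ι : Ω → EuclideanSpace ℝ (Fin d)) (m : Measure Ω) (ϖ : Ω → ℝ) where
  toLin : polys ι →ₗ[ℝ] polys ι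
  μ : Polynomial ℝ
  natDegree_μ : μ.natDegree = 2
  μ_nonneg : ∀ k : ℕ, 0 ≤ μ.eval (k : ℝ)
  eigen : ∀ (k : ℕ) (Y : polys ι), (Y : Ω → ℝ) ∈ orthoPolys ι m ϖ k →
    toLin Y = (-(μ.eval (k : ℝ))) • Y

/-- The fractional power `(-𝔇_ϖ)^{r/2} f = ∑_k μ(k)^{r/2} proj_k(ϖ; f)` on polynomials `f`
(a finite sum, see `fracPow_eq_sum`). -/
def EigenOperator.fracPow {ι : Ω → EuclideanSpace ℝ (Fin d)} {m : Measure Ω} {ϖ : Ω → ℝ}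
    (D : EigenOperator ι m ϖ) (r : ℝ) (f : Ω → ℝ) (x : Ω) : ℝ :=
  ∑ᶠ k : ℕ, (D.μ.eval (k : ℝ)) ^ (r / 2) * proj ι m ϖ k f x

/-- `L_n^{(r)}(ϖ; x, y) = ∑_k a(k/n) μ(k)^{r/2} P_k(ϖ; x, y)`. -/
def EigenOperator.locKernel {ι : Ω → EuclideanSpace ℝ (Fin d)} {m : Measure Ω} {ϖ : Ω → ℝ}
    (D : EigenOperator ι m ϖ) (a : ℝ → ℝ) (r : ℝ) (n : ℕ) (x y : Ω) : ℝ :=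
  ∑ k ∈ Finset.range (2 * n + 1),
    a ((k : ℝ) / n) * (D.μ.eval (k : ℝ)) ^ (r / 2) * repKernel ι m ϖ k x y

theorem repKernel_mem (ι : Ω → EuclideanSpace ℝ (Fin d)) (m : Measure Ω) (ϖ : Ω → ℝ) (k : ℕ)
    (x : Ω) : repKernel ι m ϖ k x ∈ orthoPolys ι m ϖ k := by
  unfold repKernel
  split_ifs with h
  · exact h.choose_spec.1
  · exact ⟨Submodule.zero_mem _, fun j _ g _ => by simp [ip]⟩

theorem fracPow_eq_sum {ι : Ω → EuclideanSpace ℝ (Fin d)} {m : Measure Ω} {ϖ : Ω → ℝ}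
    (D : EigenOperator ι m ϖ) (r : ℝ) (n : ℕ) {f : Ω → ℝ} (hf : f ∈ polysDeg ι n) (x : Ω) :
    D.fracPow r f x =
      ∑ k ∈ Finset.range (n + 1), (D.μ.eval (k : ℝ)) ^ (r / 2) * proj ι m ϖ k f x := by
  unfold EigenOperator.fracPow
  refine finsum_eq_sum_of_support_subset _ fun k hk => ?_
  by_contra hkn
  have hlt : n < k := by simpa [Nat.lt_succ_iff] using hkn
  exact hk (by simp [proj, (repKernel_mem ι m ϖ k x).2 n hlt f hf])

end OrthogonalPolynomials

section Assertions

variable [MetricSpace Ω] [MeasurableSpace Ω]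

/-- Decay of the localized kernels. -/
def Assertion1 (ι : Ω → EuclideanSpace ℝ (Fin d)) (m : Measure Ω) (ϖ : Ω → ℝ) (a : ℝ → ℝ) : Prop :=
  ∀ κ : ℝ, 0 < κ → ∃ c : ℝ, 0 < c ∧ ∀ n : ℕ, 1 ≤ n → ∀ x y : Ω,
    |locKernel ι m ϖ a n x y| ≤
      c / (√(mass m ϖ (Metric.ball x (1 / n))) * √(mass m ϖ (Metric.ball y (1 / n))) *
        (1 + n * dist x y) ^ κ)

/-- Lipschitz estimate of the localized kernels at the scale `1/n`. -/
def Assertion2 (ι : Ω → EuclideanSpace ℝ (Fin d)) (m : Measure Ω) (ϖ : Ω → ℝ) (a : ℝ → ℝ) : Prop :=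
  ∃ δ₀ : ℝ, 0 < δ₀ ∧ δ₀ < 1 ∧ ∀ κ : ℝ, 0 < κ → ∃ c : ℝ, 0 < c ∧
    ∀ n : ℕ, 1 ≤ n → ∀ δ : ℝ, 0 < δ → δ ≤ δ₀ →
      ∀ x₁ x₂ y : Ω, x₁ ∈ Metric.ball x₂ (δ / n) →
        |locKernel ι m ϖ a n x₁ y - locKernel ι m ϖ a n x₂ y| ≤
          c * (n * dist x₁ x₂) /
            (√(mass m ϖ (Metric.ball x₁ (1 / n))) * √(mass m ϖ (Metric.ball x₂ (1 / n))) *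
              (1 + n * dist x₂ y) ^ κ)

/-- Sharpness of the decay: the localized bounds are uniformly integrable. -/
def Assertion3 (m : Measure Ω) (ϖ : Ω → ℝ) : Prop :=
  ∃ κ₀ : ℝ, 0 < κ₀ ∧ ∀ κ : ℝ, κ₀ ≤ κ → ∃ c : ℝ, 0 < c ∧ ∀ n : ℕ, 1 ≤ n → ∀ x : Ω,
    ∫⁻ y, ENNReal.ofReal
      (ϖ y / (mass m ϖ (Metric.ball y (1 / n)) * (1 + n * dist x y) ^ κ)) ∂m ≤ ENNReal.ofReal c

/-- Compactness of the domain and existence of fast decaying polynomials `T_x` of degree at most `n`,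
with a multiplier `q` for which `x ↦ q(x) T_x(y)` is a polynomial of degree at most `s n`.
All constants are independent of `n`, `x`, `y`, but they, and the polynomials, may depend on the
required rate of decay `γ`. -/
def Assertion4 (ι : Ω → EuclideanSpace ℝ (Fin d)) : Prop :=
  CompactSpace Ω ∧ ∀ γ : ℝ, 1 < γ → ∃ δ c c₁ c₂ : ℝ, ∃ s : ℕ,
    0 < δ ∧ 0 < c ∧ 0 < c₁ ∧ 0 < c₂ ∧ 1 ≤ s ∧
    ∀ n : ℕ, 1 ≤ n → ∃ (T : Ω → Ω → ℝ) (q : Ω → ℝ),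
      (∀ x, T x ∈ polysDeg ι n) ∧
      (∀ x, T x x = 1) ∧
      (∀ x, ∀ y ∈ Metric.ball x (1 / n), δ ≤ T x y) ∧
      (∀ x y, 0 ≤ T x y ∧ T x y ≤ c * (1 + n * dist x y) ^ (-γ)) ∧
      q ∈ polys ι ∧
      (∀ y, (fun x => q x * T x y) ∈ polysDeg ι (s * n)) ∧
      (∀ x, c₁ ≤ q x ∧ q x ≤ c₂)

/-- Decay of the kernels `L_n^{(r)}`, for a given order `r`. -/
def Assertion5 {ι : Ω → EuclideanSpace ℝ (Fin d)} {m : Measure Ω} {ϖ : Ω → ℝ}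
    (D : EigenOperator ι m ϖ) (a : ℝ → ℝ) (r : ℝ) : Prop :=
  ∀ κ : ℝ, 0 < κ → ∃ c : ℝ, 0 < c ∧ ∀ n : ℕ, 1 ≤ n → ∀ x y : Ω,
    |D.locKernel a r n x y| ≤
      c * (n : ℝ) ^ r /
        (√(mass m ϖ (Metric.ball x (1 / n))) * √(mass m ϖ (Metric.ball y (1 / n)))) *
        (1 + n * dist x y) ^ (-κ)

end Assertions

end ConicBernstein

end

noncomputable section

namespace ConicBernstein

variable {d : ℕ} {Ω : Type*}

/-! The cut-off equals 1 on degrees at most `n`, so integration against `L_n` reproduces `f ∈ Π_n`,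
and integration against `L_n^{(r)}` gives the fractional power. Both are compared with the maximal
function `f*(x) = sup_y |f y| / (1 + n d(x,y))^β`.

Pointwise: `|f y| ≤ f*(x) (1 + n d(x,y))^β`, and the decay in Assertion 5 beats this growth.
Assertion 3 then bounds the integral, giving `|(-𝔇)^{r/2} f| ≤ C n^r f*`
(`EigenOperator.exists_abs_fracPow_le`).

Maximal inequality: `‖f*‖_{p,w} ≤ K ‖f‖_{p,w}` for finite `p` (`exists_lintegral_decayMax_le`). By
Assertion 2, `f` barely oscillates on a ball of radius `δ/n` about a near-maximizer for `f*(x)`, so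
`f*(x)^p` is dominated by an average of `|f|^p` there. Doubling of `w` turns this average into an
integral operator with a decaying kernel, and Tonelli finishes. For `p = ∞` the pointwise bound with
`β = 0` suffices. -/

theorem one_add_mul_dist_pow_inv_le {Ω : Type*} [MetricSpace Ω] (n : ℕ) (hn : 1 ≤ n) (β : ℕ) (x z : Ω) :
    ENNReal.ofReal ((1 + n * dist x z) ^ β)⁻¹ ≤
      ∑' k : ℕ, (Metric.ball z (2 ^ k * (1 / n : ℝ))).indicator
        (fun _ => ENNReal.ofReal (2 ^ β * ((2 ^ β) ^ k)⁻¹)) x := by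
  have hn' : (0 : ℝ) < n := by exact_mod_cast hn
  -- With `2^k ≤ 1 + n d(x,z) < 2^(k+1)`, the single term of index `k + 1` already dominates; the
  -- factor `2^β` pays for the shift from `k` to `k + 1`.
  obtain ⟨k, hk, hk'⟩ := exists_nat_pow_near
    (show (1 : ℝ) ≤ 1 + n * dist x z by simp; positivity) (one_lt_two (α := ℝ))
  refine le_trans ?_ (ENNReal.le_tsum (k + 1))
  rw [Set.indicator_of_mem]
  · refine ENNReal.ofReal_le_ofReal ?_
    have : (2 : ℝ) ^ β * ((2 ^ β) ^ (k + 1))⁻¹ = ((2 ^ k) ^ β)⁻¹ := by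
      field_simp; ring
    rw [this]
    gcongr
  · rw [Metric.mem_ball, mul_one_div, lt_div_iff₀ hn']
    linarith

/-! ### Growth and decay estimates for doubling weights -/

section Doubling

variable [MetricSpace Ω] [MeasurableSpace Ω] {m : Measure Ω} {w : Ω → ℝ}

/-- The measure `w dm`. -/
def weightMeasure (m : Measure Ω) (w : Ω → ℝ) : Measure Ω :=
  m.withDensity fun x => ENNReal.ofReal (w x)

theorem IsDoublingWeight.isFiniteMeasure (hw : IsDoublingWeight m w) :
    IsFiniteMeasure (weightMeasure m w) :=
  isFiniteMeasure_withDensity_ofReal hw.integrable.2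

theorem IsDoublingWeight.weightMeasure_apply (hw : IsDoublingWeight m w) {E : Set Ω}
    (hE : MeasurableSet E) : weightMeasure m w E = ENNReal.ofReal (mass m w E) := by
  rw [weightMeasure, withDensity_apply _ hE, mass,
    ofReal_integral_eq_lintegral_ofReal hw.integrable.restrict
      (Filter.Eventually.of_forall hw.nonneg)]

theorem IsDoublingWeight.mass_mono (hw : IsDoublingWeight m w) {E F : Set Ω} (h : E ⊆ F) :
    mass m w E ≤ mass m w F :=
  setIntegral_mono_set hw.integrable.integrableOn (Filter.Eventually.of_forall hw.nonneg)
    h.eventuallyLE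

theorem IsDoublingWeight.mass_nonneg (hw : IsDoublingWeight m w) (E : Set Ω) :
    0 ≤ mass m w E :=
  integral_nonneg hw.nonneg

/-- Replacing `L` by a larger power of two makes mass growth directly comparable with dyadic radii
and natural decay exponents. -/
theorem IsDoublingWeight.exists_two_pow (hw : IsDoublingWeight m w) :
    ∃ A : ℕ, ∀ (k : ℕ) (x : Ω) (ρ : ℝ), 0 < ρ →
      mass m w (Metric.ball x (2 ^ k * ρ)) ≤ (2 ^ A) ^ k * mass m w (Metric.ball x ρ) := by
  obtain ⟨L, -, h⟩ := hw.doubling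
  obtain ⟨A, hA⟩ := pow_unbounded_of_one_lt L (one_lt_two (α := ℝ))
  refine ⟨A, fun k x ρ hρ => ?_⟩
  induction k with
  | zero => simp
  | succ k ih =>
    calc mass m w (Metric.ball x (2 ^ (k + 1) * ρ))
        = mass m w (Metric.ball x (2 * (2 ^ k * ρ))) := by ring_nf
      _ ≤ L * mass m w (Metric.ball x (2 ^ k * ρ)) := h x _ (by positivity)
      _ ≤ 2 ^ A * ((2 ^ A) ^ k * mass m w (Metric.ball x ρ)) :=
        mul_le_mul hA.le ih (hw.mass_nonneg _) (by positivity)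
      _ = _ := by ring

/-- Some dyadic dilate of the ball covers the compact domain, so by doubling a null ball would force
zero total mass. -/
theorem IsDoublingWeight.mass_ball_pos [CompactSpace Ω] (hw : IsDoublingWeight m w)
    (h : 0 < ∫ x, w x ∂m) (x : Ω) {ρ : ℝ} (hρ : 0 < ρ) : 0 < mass m w (Metric.ball x ρ) := by
  obtain ⟨A, hA⟩ := hw.exists_two_pow
  obtain ⟨R, hR⟩ := (isCompact_univ (X := Ω)).isBounded.subset_ball x
  obtain ⟨k, hk⟩ := pow_unbounded_of_one_lt (R / ρ) (one_lt_two (α := ℝ))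
  have h1 : mass m w Set.univ ≤ mass m w (Metric.ball x (2 ^ k * ρ)) :=
    hw.mass_mono (hR.trans (Metric.ball_subset_ball ((div_lt_iff₀ hρ).1 hk).le))
  have h2 : mass m w Set.univ = ∫ x, w x ∂m := by simp [mass]
  have h3 := h1.trans (hA k x ρ hρ)
  exact pos_of_mul_pos_right ((h2 ▸ h).trans_le h3) (by positivity)

/-- Moving the center costs only a fixed power of `1 + n d(x,y)`, which a decaying kernel can
absorb. -/
theorem IsDoublingWeight.exists_mass_ball_le (hw : IsDoublingWeight m w) :
    ∃ A : ℕ, ∀ n : ℕ, 1 ≤ n → ∀ x y : Ω, mass m w (Metric.ball x (1 / n)) ≤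
      2 ^ A * (1 + n * dist x y) ^ A * mass m w (Metric.ball y (1 / n)) := by
  obtain ⟨A, hA⟩ := hw.exists_two_pow
  refine ⟨A, fun n hn x y => ?_⟩
  have hn' : (0 : ℝ) < n := by exact_mod_cast hn
  obtain ⟨k, hk, hk'⟩ := exists_nat_pow_near
    (show (1 : ℝ) ≤ 1 + n * dist x y by simp; positivity) (one_lt_two (α := ℝ))
  have hsub : Metric.ball x (1 / n : ℝ) ⊆ Metric.ball y (2 ^ (k + 1) * (1 / n)) := by
    refine Metric.ball_subset_ball' ?_
    rw [mul_one_div, ← sub_nonneg]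
    have : 2 ^ (k + 1) / (n : ℝ) - (1 / n + dist x y) = (2 ^ (k + 1) - (1 + n * dist x y)) / n := by
      field_simp
    rw [this]
    exact div_nonneg (by linarith) hn'.le
  refine (hw.mass_mono hsub).trans ((hA _ _ _ (by positivity)).trans ?_)
  refine mul_le_mul_of_nonneg_right ?_ (hw.mass_nonneg _)
  calc ((2 : ℝ) ^ A) ^ (k + 1) = 2 ^ A * (2 ^ k) ^ A := by ring
    _ ≤ _ := by gcongr

variable [BorelSpace Ω]

/-- Dyadic balls gain mass at most like `2^(Ak)` while the kernel decays like `2^(-(A+1)k)`; the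
remaining geometric series sums to 2. -/
theorem IsDoublingWeight.exists_lintegral_decay_le (hw : IsDoublingWeight m w) :
    ∃ β : ℕ, ∀ n : ℕ, 1 ≤ n → ∀ z : Ω,
      ∫⁻ x, ENNReal.ofReal ((1 + n * dist x z) ^ β)⁻¹ ∂(weightMeasure m w) ≤
        ENNReal.ofReal (2 ^ β * 2) * weightMeasure m w (Metric.ball z (1 / n)) := by
  obtain ⟨A, hA⟩ := hw.exists_two_pow
  refine ⟨A + 1, fun n hn z => ?_⟩
  have hn' : (0 : ℝ) < n := by exact_mod_cast hn
  set β := A + 1 with hβ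
  calc ∫⁻ x, ENNReal.ofReal ((1 + n * dist x z) ^ β)⁻¹ ∂(weightMeasure m w)
      ≤ ∫⁻ x, ∑' k : ℕ, (Metric.ball z (2 ^ k * (1 / n : ℝ))).indicator
        (fun _ => ENNReal.ofReal (2 ^ β * ((2 ^ β) ^ k)⁻¹)) x ∂(weightMeasure m w) :=
        lintegral_mono fun x => one_add_mul_dist_pow_inv_le n hn β x z
    _ = ∑' k : ℕ, ENNReal.ofReal (2 ^ β * ((2 ^ β) ^ k)⁻¹) *
          weightMeasure m w (Metric.ball z (2 ^ k * (1 / n : ℝ))) := by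
        rw [lintegral_tsum fun k =>
          (measurable_const.indicator Metric.isOpen_ball.measurableSet).aemeasurable]
        simp_rw [lintegral_indicator_const Metric.isOpen_ball.measurableSet]
    _ ≤ ∑' k : ℕ, ENNReal.ofReal (2 ^ β) * weightMeasure m w (Metric.ball z (1 / n)) *
          2⁻¹ ^ k := by
        refine ENNReal.tsum_le_tsum fun k => ?_
        rw [hw.weightMeasure_apply Metric.isOpen_ball.measurableSet,
          hw.weightMeasure_apply Metric.isOpen_ball.measurableSet,
          ← ENNReal.ofReal_mul (by positivity), ← ENNReal.ofReal_mul (by positivity)]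
        have h2 : (2⁻¹ : ℝ≥0∞) ^ k = ENNReal.ofReal ((2⁻¹ : ℝ) ^ k) := by
          rw [ENNReal.ofReal_pow (by norm_num), ENNReal.ofReal_inv_of_pos (by norm_num)]
          norm_num
        rw [h2, ← ENNReal.ofReal_mul (mul_nonneg (by positivity) (hw.mass_nonneg _))]
        refine ENNReal.ofReal_le_ofReal ?_
        calc _ ≤ 2 ^ β * ((2 ^ β) ^ k)⁻¹ * ((2 ^ A) ^ k * mass m w (Metric.ball z (1 / n))) := by
              gcongr
              exact hA k z _ (by positivity)
          _ = _ := by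
              have : ((2 : ℝ) ^ β) ^ k = (2 ^ A) ^ k * 2 ^ k := by
                rw [← mul_pow, hβ, pow_succ]
              rw [this, inv_pow]
              field_simp
    _ = _ := by
        rw [ENNReal.tsum_mul_left, ENNReal.tsum_geometric, ENNReal.one_sub_inv_two, inv_inv,
          ENNReal.ofReal_mul (by positivity)]
        simp only [ENNReal.ofReal_ofNat]
        ring

end Doubling

/-! ### Polynomial spaces: inclusion, finite dimension, continuity -/

theorem polysDeg_mono (ι : Ω → EuclideanSpace ℝ (Fin d)) {j k : ℕ} (h : j ≤ k) :
    polysDeg ι j ≤ polysDeg ι k := by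
  refine Submodule.map_mono fun p hp => ?_
  rw [MvPolynomial.mem_restrictTotalDegree] at hp ⊢
  exact hp.trans h

instance finiteDimensional_polysDeg (ι : Ω → EuclideanSpace ℝ (Fin d)) (n : ℕ) :
    FiniteDimensional ℝ (polysDeg ι n) := by
  unfold polysDeg
  infer_instance

theorem continuous_of_mem_polysDeg [TopologicalSpace Ω] {ι : Ω → EuclideanSpace ℝ (Fin d)}
    (hι : Continuous ι) {n : ℕ} {f : Ω → ℝ} (hf : f ∈ polysDeg ι n) : Continuous f := by
  obtain ⟨p, -, rfl⟩ := hf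
  have : (restrictPoly ι p) = fun x => MvPolynomial.eval (fun i => ι x i) p := by
    funext x
    simp [restrictPoly, MvPolynomial.aeval_eq_eval]
  rw [this]
  exact (MvPolynomial.continuous_eval p).comp (continuous_pi fun i => by fun_prop)

/-! ### Orthogonal expansions and reproducing formulas -/

section InnerProduct

variable [MetricSpace Ω] [CompactSpace Ω] [MeasurableSpace Ω] [BorelSpace Ω]
  {m : Measure Ω} {ϖ : Ω → ℝ}

theorem ip_comm {Ω : Type*} [MeasurableSpace Ω] (m : Measure Ω) (ϖ f g : Ω → ℝ) :
    ip m ϖ f g = ip m ϖ g f := by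
  simp only [ip, mul_comm (f _)]

theorem IsDoublingWeight.integrable_mul (hϖ : IsDoublingWeight m ϖ) {f : Ω → ℝ}
    (hf : Continuous f) : Integrable (fun x => f x * ϖ x) m := by
  obtain ⟨C, hC⟩ := isCompact_univ.exists_bound_of_continuousOn hf.continuousOn
  exact hϖ.integrable.bdd_mul hf.aestronglyMeasurable
    (Filter.Eventually.of_forall fun x => hC x trivial)

theorem IsDoublingWeight.integrable_mul_mul (hϖ : IsDoublingWeight m ϖ) {f g : Ω → ℝ}
    (hf : Continuous f) (hg : Continuous g) : Integrable (fun x => f x * g x * ϖ x) m :=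
  hϖ.integrable_mul (hf.mul hg)

theorem IsDoublingWeight.ip_add_left (hϖ : IsDoublingWeight m ϖ) {f g h : Ω → ℝ}
    (hf : Continuous f) (hg : Continuous g) (hh : Continuous h) :
    ip m ϖ (f + g) h = ip m ϖ f h + ip m ϖ g h := by
  unfold ip
  rw [← integral_add (hϖ.integrable_mul_mul hf hh) (hϖ.integrable_mul_mul hg hh)]
  simp only [Pi.add_apply, add_mul]

theorem IsDoublingWeight.ip_add_right (hϖ : IsDoublingWeight m ϖ) {f g h : Ω → ℝ}
    (hf : Continuous f) (hg : Continuous g) (hh : Continuous h) :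
    ip m ϖ h (f + g) = ip m ϖ h f + ip m ϖ h g := by
  simp only [ip_comm m ϖ h, hϖ.ip_add_left hf hg hh]

theorem ip_smul_left {Ω : Type*} [MeasurableSpace Ω] (m : Measure Ω) (ϖ f g : Ω → ℝ) (c : ℝ) :
    ip m ϖ (c • f) g = c * ip m ϖ f g := by
  simp only [ip, Pi.smul_apply, smul_eq_mul, mul_assoc, integral_const_mul]

theorem ip_smul_right {Ω : Type*} [MeasurableSpace Ω] (m : Measure Ω) (ϖ f g : Ω → ℝ) (c : ℝ) :
    ip m ϖ f (c • g) = c * ip m ϖ f g := by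
  rw [ip_comm, ip_smul_left, ip_comm]

theorem IsDoublingWeight.ip_sum_right (hϖ : IsDoublingWeight m ϖ) {α : Type*} (s : Finset α)
    {f : Ω → ℝ} {g : α → Ω → ℝ} (c : α → ℝ) (hf : Continuous f) (hg : ∀ i, Continuous (g i)) :
    ip m ϖ f (fun y => ∑ i ∈ s, c i * g i y) = ∑ i ∈ s, c i * ip m ϖ f (g i) := by
  unfold ip
  simp_rw [← integral_const_mul]
  rw [← integral_finsetSum _ fun i _ => (hϖ.integrable_mul_mul hf (hg i)).const_mul (c i)]
  refine integral_congr_ae (Filter.Eventually.of_forall fun y => ?_)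
  simp only [Finset.mul_sum, Finset.sum_mul]
  exact Finset.sum_congr rfl fun i _ => by ring

/-- A nonzero continuous function has square bounded below on some ball, and every ball has positive
mass. -/
theorem IsDoublingWeight.eq_zero_of_ip_self (hϖ : IsDoublingWeight m ϖ)
    (hpos : 0 < ∫ x, ϖ x ∂m) {f : Ω → ℝ} (hf : Continuous f) (h : ip m ϖ f f = 0) : f = 0 := by
  by_contra hne
  obtain ⟨x, hx⟩ := Function.ne_iff.1 hne
  have hx' : 0 < f x * f x := mul_self_pos.2 hx
  have hopen : IsOpen {y | f x * f x / 2 < f y * f y} :=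
    isOpen_lt continuous_const (hf.mul hf)
  obtain ⟨ρ, hρ, hball⟩ := Metric.isOpen_iff.1 hopen x (half_lt_self hx')
  have h1 : f x * f x / 2 * mass m ϖ (Metric.ball x ρ) ≤ ip m ϖ f f := by
    unfold mass ip
    rw [← integral_const_mul]
    refine le_trans (setIntegral_mono_on (hϖ.integrable.const_mul _).integrableOn
      (hϖ.integrable_mul (hf.mul hf)).integrableOn Metric.isOpen_ball.measurableSet
      fun y hy => ?_) (setIntegral_le_integral (hϖ.integrable_mul (hf.mul hf))
      (Filter.Eventually.of_forall fun y => mul_nonneg (mul_self_nonneg _) (hϖ.nonneg y)))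
    exact mul_le_mul_of_nonneg_right (hball hy).le (hϖ.nonneg y)
  have h2 := mul_pos (half_pos hx') (hϖ.mass_ball_pos hpos x hρ)
  linarith

/-- Riesz representation on a finite dimensional space of continuous functions. -/
theorem IsDoublingWeight.exists_ip_eq (hϖ : IsDoublingWeight m ϖ) (hpos : 0 < ∫ x, ϖ x ∂m)
    (V : Submodule ℝ (Ω → ℝ)) [FiniteDimensional ℝ V] (hV : ∀ f ∈ V, Continuous f)
    (φ : V →ₗ[ℝ] ℝ) : ∃ q ∈ V, ∀ f : V, ip m ϖ f q = φ f := by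
  let B : V →ₗ[ℝ] Module.Dual ℝ V := LinearMap.mk₂ ℝ (fun q f : V => ip m ϖ f q)
    (fun q q' f => hϖ.ip_add_right (hV _ q.2) (hV _ q'.2) (hV _ f.2))
    (fun c q f => ip_smul_right m ϖ _ _ c)
    (fun q f f' => hϖ.ip_add_left (hV _ f.2) (hV _ f'.2) (hV _ q.2))
    (fun c q f => ip_smul_left m ϖ _ _ c)
  have hB : Function.Injective B := by
    rw [← LinearMap.ker_eq_bot, LinearMap.ker_eq_bot']
    intro q hq
    exact Subtype.ext (hϖ.eq_zero_of_ip_self hpos (hV _ q.2) (LinearMap.congr_fun hq q))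
  obtain ⟨q, hq⟩ := (LinearMap.injective_iff_surjective_of_finrank_eq_finrank
    Subspace.dual_finrank_eq.symm).1 hB φ
  exact ⟨q, q.2, fun f => LinearMap.congr_fun hq f⟩

variable {ι : Ω → EuclideanSpace ℝ (Fin d)}

/-- One Gram–Schmidt step: `g` is the Riesz representative on `Π_n` of pairing with `f`. -/
theorem IsDoublingWeight.exists_add_orthoPolys (hϖ : IsDoublingWeight m ϖ)
    (hpos : 0 < ∫ x, ϖ x ∂m) (hι : Continuous ι) {n : ℕ} {f : Ω → ℝ}
    (hf : f ∈ polysDeg ι (n + 1)) :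
    ∃ g ∈ polysDeg ι n, ∃ Y ∈ orthoPolys ι m ϖ (n + 1), f = g + Y := by
  have hc : ∀ g ∈ polysDeg ι n, Continuous g := fun g hg => continuous_of_mem_polysDeg hι hg
  have hfc := continuous_of_mem_polysDeg hι hf
  let φ : polysDeg ι n →ₗ[ℝ] ℝ :=
    { toFun := fun g => ip m ϖ g f
      map_add' := fun g g' => hϖ.ip_add_left (hc _ g.2) (hc _ g'.2) hfc
      map_smul' := fun c g => ip_smul_left m ϖ _ _ c }
  obtain ⟨q, hq, h⟩ := hϖ.exists_ip_eq hpos (polysDeg ι n) hc φ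
  have hqf : f - q ∈ polysDeg ι (n + 1) :=
    Submodule.sub_mem _ hf (polysDeg_mono ι n.le_succ hq)
  refine ⟨q, hq, f - q, ⟨hqf, fun j hj g hg => ?_⟩, by simp⟩
  have hg' : g ∈ polysDeg ι n := polysDeg_mono ι (Nat.lt_succ_iff.1 hj) hg
  have h1 : ip m ϖ g q = ip m ϖ g f := h ⟨g, hg'⟩
  have h2 := hϖ.ip_add_right (continuous_of_mem_polysDeg hι hqf) (hc q hq) (hc g hg')
  rw [sub_add_cancel] at h2
  linarith

/-- What must be shown is that `repKernel` is not its default value 0, that is, that evaluation at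
`x` has a representative inside `V_k`. -/
theorem IsDoublingWeight.proj_eq_self (hϖ : IsDoublingWeight m ϖ)
    (hpos : 0 < ∫ x, ϖ x ∂m) (hι : Continuous ι) {k : ℕ} {Y : Ω → ℝ}
    (hY : Y ∈ orthoPolys ι m ϖ k) (x : Ω) : proj ι m ϖ k Y x = Y x := by
  have hc : ∀ k, ∀ g ∈ polysDeg ι k, Continuous g :=
    fun k g hg => continuous_of_mem_polysDeg hι hg
  have hex : ∃ q ∈ orthoPolys ι m ϖ k, ∀ f ∈ orthoPolys ι m ϖ k, ip m ϖ f q = f x := by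
    obtain ⟨q, hq, h⟩ := hϖ.exists_ip_eq hpos (polysDeg ι k) (hc k)
      ((LinearMap.proj x).comp (polysDeg ι k).subtype)
    cases k with
    | zero => exact ⟨q, ⟨hq, by simp⟩, fun f hf => h ⟨f, hf.1⟩⟩
    | succ n =>
      -- The representative in all of `Π_k` may have a lower-degree part `g`; elements of `V_k` do
      -- not see it, so the top component `Z` represents evaluation too.
      obtain ⟨g, hg, Z, hZ, rfl⟩ := hϖ.exists_add_orthoPolys hpos hι hq
      refine ⟨Z, hZ, fun f hf => ?_⟩
      have h1 : ip m ϖ f (g + Z) = f x := h ⟨f, hf.1⟩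
      rw [hϖ.ip_add_right (hc _ g hg) (hc _ Z hZ.1) (hc _ f hf.1), ip_comm m ϖ f g,
        hf.2 n n.lt_succ_self g hg, zero_add] at h1
      exact h1
  rw [proj, repKernel, dif_pos hex]
  exact hex.choose_spec.2 Y hY

theorem continuous_repKernel {Ω : Type*} [TopologicalSpace Ω] [MeasurableSpace Ω]
    {ι : Ω → EuclideanSpace ℝ (Fin d)} (hι : Continuous ι) (m : Measure Ω) (ϖ : Ω → ℝ) (k : ℕ)
    (x : Ω) : Continuous (repKernel ι m ϖ k x) :=
  continuous_of_mem_polysDeg hι (repKernel_mem ι m ϖ k x).1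

theorem proj_eq_zero {Ω : Type*} [MeasurableSpace Ω]
    {ι : Ω → EuclideanSpace ℝ (Fin d)} {m : Measure Ω} {ϖ : Ω → ℝ} {n k : ℕ} (h : n < k)
    {f : Ω → ℝ} (hf : f ∈ polysDeg ι n) (x : Ω) : proj ι m ϖ k f x = 0 :=
  (repKernel_mem ι m ϖ k x).2 n h f hf

theorem IsDoublingWeight.sum_proj (hϖ : IsDoublingWeight m ϖ)
    (hpos : 0 < ∫ x, ϖ x ∂m) (hι : Continuous ι) {n : ℕ} {f : Ω → ℝ}
    (hf : f ∈ polysDeg ι n) (x : Ω) : ∑ k ∈ Finset.range (n + 1), proj ι m ϖ k f x = f x := by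
  induction n generalizing f with
  | zero => simpa using hϖ.proj_eq_self hpos hι ⟨hf, by simp⟩ x
  | succ n ih =>
    obtain ⟨g, hg, Y, hY, rfl⟩ := hϖ.exists_add_orthoPolys hpos hι hf
    have hadd : ∀ k, proj ι m ϖ k (g + Y) x = proj ι m ϖ k g x + proj ι m ϖ k Y x := fun k =>
      hϖ.ip_add_left (continuous_of_mem_polysDeg hι hg) (continuous_of_mem_polysDeg hι hY.1)
        (continuous_repKernel hι m ϖ k x)
    have hzero : ∀ k ∈ Finset.range (n + 1), proj ι m ϖ k Y x = 0 := fun k hk => by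
      rw [proj, ip_comm]
      exact hY.2 k (Finset.mem_range.1 hk) _ (repKernel_mem ι m ϖ k x).1
    simp_rw [hadd]
    rw [Finset.sum_add_distrib, Finset.sum_range_succ, ih hg, proj_eq_zero n.lt_succ_self hg,
      Finset.sum_range_succ, Finset.sum_eq_zero hzero, hϖ.proj_eq_self hpos hι hY]
    simp

variable {a : ℝ → ℝ}

theorem IsCutoff.apply_div_eq_one (ha : IsCutoff a) {k n : ℕ} (h : k ≤ n) :
    a ((k : ℝ) / n) = 1 :=
  ha.eq_one _ ⟨by positivity, div_le_one_of_le₀ (by exact_mod_cast h) (by positivity)⟩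

/-- The cut-off is 1 for `k ≤ n`, and the projections of `f` vanish beyond. The free multiplier `c`
serves both `L_n` and `L_n^{(r)}`. -/
theorem sum_cutoff_mul_proj {Ω : Type*} [MeasurableSpace Ω]
    {ι : Ω → EuclideanSpace ℝ (Fin d)} {m : Measure Ω} {ϖ : Ω → ℝ} (ha : IsCutoff a) {n : ℕ}
    {f : Ω → ℝ} (hf : f ∈ polysDeg ι n) (x : Ω) (c : ℕ → ℝ) :
    ∑ k ∈ Finset.range (2 * n + 1), a ((k : ℝ) / n) * c k * proj ι m ϖ k f x =
      ∑ k ∈ Finset.range (n + 1), c k * proj ι m ϖ k f x := by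
  rw [← Finset.sum_subset (Finset.range_mono (show n + 1 ≤ 2 * n + 1 by omega))]
  · refine Finset.sum_congr rfl fun k hk => ?_
    rw [ha.apply_div_eq_one (Nat.lt_succ_iff.1 (Finset.mem_range.1 hk)), one_mul]
  · intro k _ hk
    rw [proj_eq_zero (by simpa using hk) hf, mul_zero]

theorem IsDoublingWeight.ip_locKernel (hϖ : IsDoublingWeight m ϖ)
    (hpos : 0 < ∫ x, ϖ x ∂m) (hι : Continuous ι) (ha : IsCutoff a) {n : ℕ} {f : Ω → ℝ}
    (hf : f ∈ polysDeg ι n) (x : Ω) : ip m ϖ f (locKernel ι m ϖ a n x) = f x := by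
  have h := sum_cutoff_mul_proj (m := m) (ϖ := ϖ) ha hf x (fun _ => 1)
  simp only [one_mul, mul_one, hϖ.sum_proj hpos hι hf] at h
  rw [← h]
  exact hϖ.ip_sum_right _ _ (continuous_of_mem_polysDeg hι hf) (continuous_repKernel hι m ϖ · x)

theorem EigenOperator.ip_locKernel (D : EigenOperator ι m ϖ) (hϖ : IsDoublingWeight m ϖ)
    (hι : Continuous ι) (ha : IsCutoff a) (r : ℝ) {n : ℕ} {f : Ω → ℝ}
    (hf : f ∈ polysDeg ι n) (x : Ω) :
    ip m ϖ f (D.locKernel a r n x) = D.fracPow r f x := by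
  rw [fracPow_eq_sum D r n hf, ← sum_cutoff_mul_proj ha hf]
  exact hϖ.ip_sum_right _ _ (continuous_of_mem_polysDeg hι hf) (continuous_repKernel hι m ϖ · x)

theorem continuous_locKernel {Ω : Type*} [TopologicalSpace Ω] [MeasurableSpace Ω]
    {ι : Ω → EuclideanSpace ℝ (Fin d)} (hι : Continuous ι) (m : Measure Ω) (ϖ : Ω → ℝ)
    (a : ℝ → ℝ) (n : ℕ) (x : Ω) : Continuous (locKernel ι m ϖ a n x) :=
  continuous_finsetSum _ fun k _ => continuous_const.mul (continuous_repKernel hι m ϖ k x)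

end InnerProduct

/-! ### The maximal function with polynomial decay -/

section MaximalFunction

variable [MetricSpace Ω]

/-- The maximal function `f*(x) = sup_y |f y| / (1 + n d(x,y))^β`. -/
def decayMax (n β : ℕ) (f : Ω → ℝ) (x : Ω) : ℝ :=
  ⨆ y, |f y| / (1 + n * dist x y) ^ β

variable {n β : ℕ} {f : Ω → ℝ}

theorem decayMax_nonneg (n β : ℕ) (f : Ω → ℝ) (x : Ω) : 0 ≤ decayMax n β f x :=
  Real.iSup_nonneg fun _ => by positivity

theorem abs_div_pow_le_abs (n β : ℕ) (f : Ω → ℝ) (x y : Ω) :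
    |f y| / (1 + n * dist x y) ^ β ≤ |f y| :=
  div_le_self (abs_nonneg _) (one_le_pow₀ (le_add_of_nonneg_right (by positivity)))

theorem decayMax_le {C : ℝ} (hC : ∀ y, |f y| ≤ C) (x : Ω) : decayMax n β f x ≤ C :=
  have : Nonempty Ω := ⟨x⟩
  ciSup_le fun y => (abs_div_pow_le_abs n β f x y).trans (hC y)

theorem one_add_mul_dist_triangle (n : ℕ) (x y z : Ω) :
    1 + n * dist x z ≤ (1 + n * dist x y) * (1 + n * dist y z) := by
  have h1 : (n : ℝ) * dist x z ≤ n * (dist x y + dist y z) :=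
    mul_le_mul_of_nonneg_left (dist_triangle x y z) n.cast_nonneg
  have h2 : 0 ≤ (n : ℝ) * dist x y * (n * dist y z) := by positivity
  nlinarith

variable [CompactSpace Ω]

theorem bddAbove_decayMax (hf : Continuous f) (n β : ℕ) (x : Ω) :
    BddAbove (Set.range fun y => |f y| / (1 + n * dist x y) ^ β) := by
  obtain ⟨C, hC⟩ := isCompact_univ.exists_bound_of_continuousOn hf.continuousOn
  refine ⟨C, ?_⟩
  rintro _ ⟨y, rfl⟩
  exact (abs_div_pow_le_abs n β f x y).trans (hC y trivial)

theorem abs_le_decayMax_mul (hf : Continuous f) (n β : ℕ) (x y : Ω) :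
    |f y| ≤ decayMax n β f x * (1 + n * dist x y) ^ β :=
  (div_le_iff₀ (by positivity)).1 (le_ciSup (bddAbove_decayMax hf n β x) y)

/-- By submultiplicativity of `1 + n d`, the maximal function is essentially constant at scale
`1/n`. -/
theorem decayMax_le_mul (hf : Continuous f) (n β : ℕ) (x y : Ω) :
    decayMax n β f y ≤ decayMax n β f x * (1 + n * dist x y) ^ β := by
  have : Nonempty Ω := ⟨x⟩
  refine ciSup_le fun z => (div_le_iff₀ (by positivity)).2 ?_
  refine (abs_le_decayMax_mul hf n β x z).trans ?_
  rw [mul_assoc, ← mul_pow]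
  exact mul_le_mul_of_nonneg_left (pow_le_pow_left₀ (by positivity)
    (one_add_mul_dist_triangle n x y z) β) (decayMax_nonneg n β f x)

end MaximalFunction

/-! ### Pointwise bounds by the maximal function -/

section KernelEstimates

variable [MetricSpace Ω] [MeasurableSpace Ω] {m : Measure Ω} {ϖ : Ω → ℝ}

theorem IsDoublingWeight.abs_ip_le (hϖ : IsDoublingWeight m ϖ) {n : ℕ} {x : Ω}
    {κ C : ℝ} (hC : 0 < C)
    (h3 : ∫⁻ y, ENNReal.ofReal
      (ϖ y / (mass m ϖ (Metric.ball y (1 / n)) * (1 + n * dist x y) ^ κ)) ∂m ≤ ENNReal.ofReal C)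
    {f H : Ω → ℝ} {K : ℝ} (hK : 0 ≤ K)
    (h : ∀ y, |f y * H y| ≤ K / (mass m ϖ (Metric.ball y (1 / n)) * (1 + n * dist x y) ^ κ)) :
    |ip m ϖ f H| ≤ C * K := by
  have key : ‖ip m ϖ f H‖ₑ ≤ ENNReal.ofReal (C * K) := by
    calc ‖ip m ϖ f H‖ₑ ≤ ∫⁻ y, ‖f y * H y * ϖ y‖ₑ ∂m := enorm_integral_le_lintegral_enorm _
      _ ≤ ∫⁻ y, ENNReal.ofReal K * ENNReal.ofReal
          (ϖ y / (mass m ϖ (Metric.ball y (1 / n)) * (1 + n * dist x y) ^ κ)) ∂m := by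
        refine lintegral_mono fun y => ?_
        rw [← ENNReal.ofReal_mul hK, Real.enorm_eq_ofReal_abs, abs_mul, abs_of_nonneg (hϖ.nonneg y)]
        refine ENNReal.ofReal_le_ofReal ((mul_le_mul_of_nonneg_right (h y) (hϖ.nonneg y)).trans_eq ?_)
        ring
      _ ≤ ENNReal.ofReal (C * K) := by
        rw [lintegral_const_mul' _ _ ENNReal.ofReal_ne_top, mul_comm C, ENNReal.ofReal_mul hK]
        gcongr
  rw [Real.enorm_eq_ofReal_abs] at key
  exact (ENNReal.ofReal_le_ofReal_iff (by positivity)).1 key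

/-- Kernels with enough decay are controlled by the maximal function. -/
theorem IsDoublingWeight.exists_abs_ip_le_decayMax [CompactSpace Ω]
    (hϖ : IsDoublingWeight m ϖ) (hpos : 0 < ∫ x, ϖ x ∂m) (h3 : Assertion3 m ϖ) (β : ℕ) :
    ∃ (κ : ℕ) (C : ℝ), 0 < C ∧ ∀ n : ℕ, 1 ≤ n → ∀ f : Ω → ℝ, Continuous f →
      ∀ (x : Ω) (H : Ω → ℝ) (E : ℝ), 0 ≤ E →
      (∀ y, |H y| ≤ E / (mass m ϖ (Metric.ball y (1 / n)) * (1 + n * dist x y) ^ κ)) →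
      |ip m ϖ f H| ≤ C * (decayMax n β f x * E) := by
  obtain ⟨κ₀, -, h⟩ := h3
  obtain ⟨l, hl⟩ := exists_nat_ge κ₀
  obtain ⟨C, hC, hC'⟩ := h l hl
  -- The exponent `β` cancels the growth of `f` relative to its maximal function; `l ≥ κ₀` is left
  -- for Assertion 3.
  refine ⟨β + l, C, hC, fun n hn f hf x H E hE hH => ?_⟩
  refine hϖ.abs_ip_le hC (hC' n hn x) (mul_nonneg (decayMax_nonneg n β f x) hE) fun y => ?_
  have hm := hϖ.mass_ball_pos hpos y (show (0 : ℝ) < 1 / n by positivity)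
  have ht : 0 < 1 + n * dist x y := by positivity
  rw [abs_mul, Real.rpow_natCast]
  refine (mul_le_mul (abs_le_decayMax_mul hf n β x y) (hH y) (abs_nonneg _)
    (mul_nonneg (decayMax_nonneg n β f x) (by positivity))).trans_eq ?_
  rw [pow_add]
  field_simp

/-- Converts the product of square roots in the kernel bounds into the mass of a ball about the
integration variable, as Assertion 3 requires. -/
theorem le_mul_sqrt_mul_sqrt {U X Y e : ℝ} (hU : 0 ≤ U) (he : 0 ≤ e) (hX : U ≤ e * X)
    (hY : U ≤ e * Y) : U ≤ e * (√X * √Y) := by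
  calc U = √U * √U := (Real.mul_self_sqrt hU).symm
    _ ≤ √(e * X) * √(e * Y) := by gcongr
    _ = (√e * √e) * (√X * √Y) := by rw [Real.sqrt_mul he, Real.sqrt_mul he]; ring
    _ = _ := by rw [Real.mul_self_sqrt he]

variable [CompactSpace Ω] [BorelSpace Ω] {ι : Ω → EuclideanSpace ℝ (Fin d)} {a : ℝ → ℝ}

theorem EigenOperator.exists_abs_fracPow_le (D : EigenOperator ι m ϖ)
    (hϖ : IsDoublingWeight m ϖ) (hpos : 0 < ∫ x, ϖ x ∂m) (hι : Continuous ι) (ha : IsCutoff a)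
    {r : ℝ} (h3 : Assertion3 m ϖ) (h5 : Assertion5 D a r) (β : ℕ) :
    ∃ C : ℝ, 0 < C ∧ ∀ n : ℕ, 1 ≤ n → ∀ f ∈ polysDeg ι n, ∀ x : Ω,
      |D.fracPow r f x| ≤ C * (n : ℝ) ^ r * decayMax n β f x := by
  obtain ⟨κ, C, hC, hip⟩ := hϖ.exists_abs_ip_le_decayMax hpos h3 β
  obtain ⟨A, hA⟩ := hϖ.exists_mass_ball_le
  -- The extra `A` pays for comparing ball masses at `x` and `y`; the `1` only keeps the exponent
  -- positive.
  obtain ⟨c, hc, h⟩ := h5 ((κ + A + 1 : ℕ) : ℝ) (by positivity)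
  refine ⟨C * (c * 2 ^ A), by positivity, fun n hn f hf x => ?_⟩
  rw [← D.ip_locKernel hϖ hι ha r hf x]
  refine (hip n hn f (continuous_of_mem_polysDeg hι hf) x (D.locKernel a r n x)
    (c * 2 ^ A * (n : ℝ) ^ r) (by positivity) fun y => ?_).trans_eq (by ring)
  refine (h n hn x y).trans ?_
  have hr : (0 : ℝ) < 1 / n := by positivity
  have hx := hϖ.mass_ball_pos hpos x hr
  have hy := hϖ.mass_ball_pos hpos y hr
  have hU : mass m ϖ (Metric.ball y (1 / n)) ≤ 2 ^ A * (1 + n * dist x y) ^ A *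
      (√(mass m ϖ (Metric.ball x (1 / n))) * √(mass m ϖ (Metric.ball y (1 / n)))) := by
    refine le_mul_sqrt_mul_sqrt hy.le (by positivity) (dist_comm x y ▸ hA n hn y x)
      (le_mul_of_one_le_left hy.le ?_)
    exact one_le_mul_of_one_le_of_one_le (one_le_pow₀ one_le_two)
      (one_le_pow₀ (le_add_of_nonneg_right (by positivity)))
  set S := √(mass m ϖ (Metric.ball x (1 / n))) * √(mass m ϖ (Metric.ball y (1 / n)))
  set U := mass m ϖ (Metric.ball y (1 / n))
  have hS : 0 < S := mul_pos (Real.sqrt_pos.2 hx) (Real.sqrt_pos.2 hy)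
  set t := 1 + n * dist x y with ht_def
  have ht : 1 ≤ t := le_add_of_nonneg_right (by positivity)
  have ht0 : 0 < t := by linarith
  rw [Real.rpow_neg ht0.le, Real.rpow_natCast, ← div_eq_mul_inv, div_div,
    div_le_div_iff₀ (by positivity) (by positivity)]
  calc c * (n : ℝ) ^ r * (U * t ^ κ) ≤ c * (n : ℝ) ^ r * ((2 ^ A * t ^ A * S) * t ^ κ) := by
        gcongr
    _ = c * 2 ^ A * (n : ℝ) ^ r * (S * t ^ (κ + A)) := by ring
    _ ≤ _ := mul_le_mul_of_nonneg_left (mul_le_mul_of_nonneg_left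
        (pow_le_pow_right₀ ht (by omega)) hS.le) (by positivity)

/-- The difference `f z - f y` is the pairing of `f` with a difference of kernels, where Assertion 2
supplies the small factor `n d(z,y) ≤ δ`. -/
theorem exists_abs_sub_le_decayMax
    (hϖ : IsDoublingWeight m ϖ) (hpos : 0 < ∫ x, ϖ x ∂m) (hι : Continuous ι) (ha : IsCutoff a)
    (h2 : Assertion2 ι m ϖ a) (h3 : Assertion3 m ϖ) (β : ℕ) :
    ∃ δ₀ C : ℝ, 0 < δ₀ ∧ δ₀ < 1 ∧ 0 < C ∧ ∀ n : ℕ, 1 ≤ n → ∀ f ∈ polysDeg ι n,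
      ∀ δ : ℝ, 0 < δ → δ ≤ δ₀ → ∀ y : Ω, ∀ z ∈ Metric.ball y (δ / n),
        |f z - f y| ≤ C * δ * decayMax n β f y := by
  obtain ⟨κ, C, hC, hip⟩ := hϖ.exists_abs_ip_le_decayMax hpos h3 β
  obtain ⟨A, hA⟩ := hϖ.exists_mass_ball_le
  obtain ⟨δ₀, hδ₀, hδ₁, h⟩ := h2
  obtain ⟨c, hc, h⟩ := h ((κ + A + 1 : ℕ) : ℝ) (by positivity)
  refine ⟨δ₀, C * (c * 4 ^ A), hδ₀, hδ₁, by positivity, fun n hn f hf δ hδ hδ' y z hz => ?_⟩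
  have hn' : (0 : ℝ) < n := by exact_mod_cast hn
  have hfc := continuous_of_mem_polysDeg hι hf
  have hsub : f z - f y = ip m ϖ f (locKernel ι m ϖ a n z - locKernel ι m ϖ a n y) := by
    have h1 := hϖ.ip_add_right ((continuous_locKernel hι m ϖ a n z).sub
      (continuous_locKernel hι m ϖ a n y)) (continuous_locKernel hι m ϖ a n y) hfc
    rw [sub_add_cancel, hϖ.ip_locKernel hpos hι ha hf, hϖ.ip_locKernel hpos hι ha hf] at h1
    rw [h1]
    exact add_sub_cancel_right _ _
  rw [hsub]
  refine (hip n hn f hfc y _ (c * 4 ^ A * δ) (by positivity) fun u => ?_).trans_eq (by ring)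
  refine (h n hn δ hδ hδ' z y u hz).trans ?_
  have hr : (0 : ℝ) < 1 / n := by positivity
  have hmy := hϖ.mass_ball_pos hpos y hr
  have hmz := hϖ.mass_ball_pos hpos z hr
  have hmu := hϖ.mass_ball_pos hpos u hr
  have hzy : n * dist z y ≤ δ := by
    rw [mul_comm, ← le_div_iff₀ hn']; exact (Metric.mem_ball.1 hz).le
  have ht : 1 ≤ 1 + n * dist y u := le_add_of_nonneg_right (by positivity)
  have hzu : 1 + n * dist u z ≤ 2 * (1 + n * dist y u) := by
    have := one_add_mul_dist_triangle n u y z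
    rw [dist_comm u y, dist_comm y z] at this
    nlinarith
  have hU : mass m ϖ (Metric.ball u (1 / n)) ≤ 4 ^ A * (1 + n * dist y u) ^ A *
      (√(mass m ϖ (Metric.ball z (1 / n))) * √(mass m ϖ (Metric.ball y (1 / n)))) := by
    refine le_mul_sqrt_mul_sqrt hmu.le (by positivity) ?_ ?_
    · refine (hA n hn u z).trans (mul_le_mul_of_nonneg_right ?_ hmz.le)
      rw [← mul_pow, ← mul_pow]
      exact pow_le_pow_left₀ (by positivity) (by linarith) A
    · refine (hA n hn u y).trans (mul_le_mul_of_nonneg_right ?_ hmy.le)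
      rw [dist_comm u y]
      gcongr
      norm_num
  set S := √(mass m ϖ (Metric.ball z (1 / n))) * √(mass m ϖ (Metric.ball y (1 / n)))
  set U := mass m ϖ (Metric.ball u (1 / n))
  have hS : 0 < S := mul_pos (Real.sqrt_pos.2 hmz) (Real.sqrt_pos.2 hmy)
  set t := 1 + n * dist y u with ht_def
  have ht0 : 0 < t := by linarith
  rw [Real.rpow_natCast, div_le_div_iff₀ (by positivity) (by positivity)]
  calc c * (n * dist z y) * (U * t ^ κ) ≤ c * δ * ((4 ^ A * t ^ A * S) * t ^ κ) := by
        gcongr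
    _ = c * 4 ^ A * δ * (S * t ^ (κ + A)) := by ring
    _ ≤ _ := mul_le_mul_of_nonneg_left (mul_le_mul_of_nonneg_left
        (pow_le_pow_right₀ ht (by omega)) hS.le) (by positivity)

/-- The maximal function is realized on a whole ball of radius comparable to `1/n`. -/
theorem exists_decayMax_mul_le_on_ball
    (hϖ : IsDoublingWeight m ϖ) (hpos : 0 < ∫ x, ϖ x ∂m) (hι : Continuous ι) (ha : IsCutoff a)
    (h2 : Assertion2 ι m ϖ a) (h3 : Assertion3 m ϖ) (β : ℕ) :
    ∃ δ : ℝ, 0 < δ ∧ δ < 1 ∧ ∀ n : ℕ, 1 ≤ n → ∀ f ∈ polysDeg ι n, ∀ x : Ω, ∃ y : Ω,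
      ∀ z ∈ Metric.ball y (δ / n), decayMax n β f x * (1 + n * dist x y) ^ β ≤ 2 * |f z| := by
  obtain ⟨δ₀, C, hδ₀, hδ₁, hC, h⟩ := exists_abs_sub_le_decayMax hϖ hpos hι ha h2 h3 β
  -- A near-maximizer attains 3/4 of the supremum and this radius limits the oscillation to 1/4,
  -- leaving the 1/2 behind the factor 2.
  refine ⟨min δ₀ (1 / (4 * C)), by positivity, (min_le_left _ _).trans_lt hδ₁,
    fun n hn f hf x => ?_⟩
  set δ := min δ₀ (1 / (4 * C))
  have hCδ : C * δ ≤ 1 / 4 := by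
    calc C * δ ≤ C * (1 / (4 * C)) := by gcongr; exact min_le_right _ _
      _ = 1 / 4 := by field_simp
  have hfc := continuous_of_mem_polysDeg hι hf
  rcases (decayMax_nonneg n β f x).eq_or_lt with h0 | h0
  -- A strict near-maximizer exists only for a positive supremum; otherwise any center works.
  · exact ⟨x, fun z _ => by rw [← h0, zero_mul]; positivity⟩
  have : Nonempty Ω := ⟨x⟩
  obtain ⟨y, hy⟩ := exists_lt_of_lt_ciSup
    (show 3 / 4 * decayMax n β f x < ⨆ y, |f y| / (1 + n * dist x y) ^ β by
      change _ < decayMax n β f x; linarith)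
  refine ⟨y, fun z hz => ?_⟩
  rw [lt_div_iff₀ (by positivity)] at hy
  have h1 := h n hn f hf δ (by positivity) (min_le_left _ _) y z hz
  have h4 : C * δ * decayMax n β f y ≤ 1 / 4 * (decayMax n β f x * (1 + n * dist x y) ^ β) :=
    mul_le_mul hCδ (decayMax_le_mul hfc n β x y) (decayMax_nonneg _ _ _ _) (by norm_num)
  have h5 : |f y| - |f z| ≤ |f z - f y| := by
    rw [abs_sub_comm]; exact abs_sub_abs_le_abs_sub _ _
  nlinarith

end KernelEstimates

/-! ### The weighted maximal inequality -/

section MaximalInequality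

variable [MetricSpace Ω] [MeasurableSpace Ω] [BorelSpace Ω] [CompactSpace Ω]
  {m : Measure Ω} {w ϖ : Ω → ℝ}

/-- If `f` is large on a ball of radius `δ/n`, then its weighted average is large. -/
theorem IsDoublingWeight.exists_rpow_le_lintegral (hw : IsDoublingWeight m w)
    (hwpos : 0 < ∫ x, w x ∂m) (β : ℕ) {δ : ℝ} (hδ : 0 < δ) (hδ1 : δ < 1) :
    ∃ C : ℝ, 1 ≤ C ∧ ∀ n : ℕ, 1 ≤ n → ∀ (f : Ω → ℝ) (M : ℝ), 0 ≤ M → ∀ x y : Ω,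
      (∀ z ∈ Metric.ball y (δ / n), M * (1 + n * dist x y) ^ β ≤ 2 * |f z|) →
      ∀ q : ℝ, 1 ≤ q →
      ENNReal.ofReal M ^ q ≤ ENNReal.ofReal (2 ^ q * C) *
        ∫⁻ z, ‖f z‖ₑ ^ q * ENNReal.ofReal ((1 + n * dist x z) ^ β)⁻¹ *
          (weightMeasure m w (Metric.ball z (1 / n)))⁻¹ ∂(weightMeasure m w) := by
  have := hw.isFiniteMeasure
  obtain ⟨A, hA⟩ := hw.exists_two_pow
  -- Chosen so that `1 + δ ≤ 2 < 2^j δ`: then `B(z, 1/n) ⊆ B(y, 2^j δ/n)` for every `z ∈ B(y, δ/n)`.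
  obtain ⟨j, hj⟩ := pow_unbounded_of_one_lt (2 / δ) (one_lt_two (α := ℝ))
  rw [div_lt_iff₀ hδ] at hj
  refine ⟨2 ^ β * (2 ^ A) ^ j, one_le_mul_of_one_le_of_one_le (one_le_pow₀ one_le_two)
    (one_le_pow₀ (one_le_pow₀ one_le_two)), fun n hn f M hM x y hf q hq => ?_⟩
  have hn' : (0 : ℝ) < n := by exact_mod_cast hn
  set ν := weightMeasure m w with hν
  set C := (2 : ℝ) ^ β * (2 ^ A) ^ j with hC
  have hball : ∀ z ρ, 0 < ρ → ν (Metric.ball z ρ) ≠ 0 := fun z ρ hρ => by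
    rw [hw.weightMeasure_apply Metric.isOpen_ball.measurableSet]
    simpa using hw.mass_ball_pos hwpos z hρ
  set B := Metric.ball y (δ / n)
  have hB0 : ν B ≠ 0 := hball y _ (by positivity)
  have hpt : ∀ z ∈ B, ENNReal.ofReal M ^ q ≤
      ENNReal.ofReal (2 ^ q * 2 ^ β) * (‖f z‖ₑ ^ q * ENNReal.ofReal ((1 + n * dist x z) ^ β)⁻¹) := by
    intro z hz
    rw [Real.enorm_eq_ofReal_abs, ENNReal.ofReal_rpow_of_nonneg hM (by linarith),
      ENNReal.ofReal_rpow_of_nonneg (abs_nonneg _) (by linarith),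
      ← ENNReal.ofReal_mul (by positivity), ← ENNReal.ofReal_mul (by positivity)]
    refine ENNReal.ofReal_le_ofReal ?_
    have hyz : n * dist y z ≤ δ := by
      rw [mul_comm, ← le_div_iff₀ hn', dist_comm]; exact (Metric.mem_ball.1 hz).le
    have hxz : 1 + n * dist x z ≤ 2 * (1 + n * dist x y) := by
      have h1 := one_add_mul_dist_triangle n x y z
      have h2 : (0 : ℝ) ≤ n * dist x y := by positivity
      nlinarith
    set t := 1 + n * dist x y with ht_def
    have ht : 1 ≤ t := le_add_of_nonneg_right (by positivity)
    have ht0 : 0 < t := by linarith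
    have h1 : M ≤ 2 * |f z| * (t ^ β)⁻¹ := by
      rw [← div_eq_mul_inv, le_div_iff₀ (by positivity)]; exact hf z hz
    have h2 : (t ^ β)⁻¹ ≤ 2 ^ β * ((1 + n * dist x z) ^ β)⁻¹ := by
      rw [← div_eq_mul_inv, inv_le_comm₀ (by positivity) (by positivity), inv_div,
        div_le_iff₀ (by positivity), ← mul_pow, mul_comm _ (2 : ℝ)]
      exact pow_le_pow_left₀ (by positivity) hxz β
    -- Discarding the power `q` here keeps `β` and `C` independent of `q`.
    have h3 : ((t ^ β)⁻¹) ^ q ≤ (t ^ β)⁻¹ :=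
      Real.rpow_le_self_of_le_one (by positivity) (inv_le_one_of_one_le₀ (one_le_pow₀ ht)) hq
    calc M ^ q ≤ (2 * |f z| * (t ^ β)⁻¹) ^ q := by gcongr
      _ = 2 ^ q * |f z| ^ q * ((t ^ β)⁻¹) ^ q := by
        rw [Real.mul_rpow (by positivity) (by positivity), Real.mul_rpow (by positivity)
          (by positivity)]
      _ ≤ 2 ^ q * |f z| ^ q * (2 ^ β * ((1 + n * dist x z) ^ β)⁻¹) := by
        gcongr; exact h3.trans h2
      _ = _ := by ring
  -- The center `y` depends on `x` in an uncontrolled way; normalizing by a ball about `z` removes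
  -- `y` from the final bound.
  have hinv : ∀ z ∈ B, (ν B)⁻¹ ≤
      ENNReal.ofReal ((2 ^ A) ^ j) * (ν (Metric.ball z (1 / n)))⁻¹ := by
    intro z hz
    have h1 : ν (Metric.ball z (1 / n)) ≤ ENNReal.ofReal ((2 ^ A) ^ j) * ν B := by
      rw [hw.weightMeasure_apply Metric.isOpen_ball.measurableSet,
        hw.weightMeasure_apply Metric.isOpen_ball.measurableSet,
        ← ENNReal.ofReal_mul (by positivity)]
      refine ENNReal.ofReal_le_ofReal (le_trans (hw.mass_mono ?_) (hA j y _ (by positivity)))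
      refine Metric.ball_subset_ball' ?_
      have h1 := (Metric.mem_ball.1 hz).le
      calc 1 / (n : ℝ) + dist z y ≤ 1 / n + δ / n := by gcongr
        _ = (1 + δ) / n := by ring
        _ ≤ (2 ^ j * δ) / n := by gcongr; linarith
        _ = _ := by ring
    have hz0 := hball z (1 / n) (by positivity)
    rw [ENNReal.inv_le_iff_le_mul (fun _ => hB0) (fun h => absurd h (measure_ne_top _ _)),
      ← ENNReal.mul_inv_cancel hz0 (measure_ne_top _ _), ← mul_assoc, mul_comm (ν B)]
    gcongr
  calc ENNReal.ofReal M ^ q = ∫⁻ _ in B, ENNReal.ofReal M ^ q * (ν B)⁻¹ ∂ν := by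
        rw [setLIntegral_const, mul_assoc, ENNReal.inv_mul_cancel hB0 (measure_ne_top _ _), mul_one]
    _ ≤ ∫⁻ z in B, ENNReal.ofReal (2 ^ q * C) *
          (‖f z‖ₑ ^ q * ENNReal.ofReal ((1 + n * dist x z) ^ β)⁻¹ *
          (ν (Metric.ball z (1 / n)))⁻¹) ∂ν := by
        refine setLIntegral_mono' Metric.isOpen_ball.measurableSet fun z hz => ?_
        refine (mul_le_mul' (hpt z hz) (hinv z hz)).trans_eq ?_
        rw [hC, ← mul_assoc (2 ^ q), ENNReal.ofReal_mul (q := (2 ^ A) ^ j) (by positivity)]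
        ring
    _ ≤ ∫⁻ z, ENNReal.ofReal (2 ^ q * C) *
          (‖f z‖ₑ ^ q * ENNReal.ofReal ((1 + n * dist x z) ^ β)⁻¹ *
          (ν (Metric.ball z (1 / n)))⁻¹) ∂ν := setLIntegral_le_lintegral _ _
    _ = _ := lintegral_const_mul' _ _ ENNReal.ofReal_ne_top

theorem measurable_measure_ball {Ω : Type*} [MetricSpace Ω] [MeasurableSpace Ω] [BorelSpace Ω]
    [SecondCountableTopology Ω] (ν : Measure Ω) [SFinite ν] (ρ : ℝ) :
    Measurable fun z => ν (Metric.ball z ρ) := by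
  have h : MeasurableSet {p : Ω × Ω | dist p.2 p.1 < ρ} :=
    (isOpen_lt (by fun_prop) continuous_const).measurableSet
  exact measurable_measure_prodMk_left h

/-- After Tonelli, integrating the kernel in `x` produces the mass of `B(z, 1/n)`, which cancels the
normalization. -/
theorem lintegral_lintegral_decay_le (hw : IsDoublingWeight m w) (hwpos : 0 < ∫ x, w x ∂m)
    {β n : ℕ} (hn : 1 ≤ n) {K : ℝ≥0∞}
    (hβ : ∀ z : Ω, ∫⁻ x, ENNReal.ofReal ((1 + n * dist x z) ^ β)⁻¹ ∂(weightMeasure m w) ≤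
        K * weightMeasure m w (Metric.ball z (1 / n)))
    {f : Ω → ℝ} (hf : Continuous f) {q : ℝ} :
    ∫⁻ x, ∫⁻ z, ‖f z‖ₑ ^ q * ENNReal.ofReal ((1 + n * dist x z) ^ β)⁻¹ *
          (weightMeasure m w (Metric.ball z (1 / n)))⁻¹ ∂(weightMeasure m w) ∂(weightMeasure m w) ≤
      K * ∫⁻ z, ‖f z‖ₑ ^ q ∂(weightMeasure m w) := by
  have := hw.isFiniteMeasure
  have : SecondCountableTopology Ω := inferInstance
  set ν := weightMeasure m w with hν
  have hmeas : Measurable fun z => (ν (Metric.ball z (1 / n)))⁻¹ :=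
    (measurable_measure_ball ν _).inv
  have hfm : Measurable fun z => ‖f z‖ₑ ^ q := hf.measurable.enorm.pow_const q
  have hk : Measurable fun p : Ω × Ω => ENNReal.ofReal ((1 + n * dist p.1 p.2) ^ β)⁻¹ := by
    refine ENNReal.measurable_ofReal.comp (Measurable.inv (Continuous.measurable ?_))
    fun_prop
  rw [lintegral_lintegral_swap (Measurable.aemeasurable
    (((hfm.comp measurable_snd).mul hk).mul (hmeas.comp measurable_snd))),
    ← lintegral_const_mul _ hfm]
  refine lintegral_mono fun z => ?_
  have h0 : ν (Metric.ball z (1 / n)) ≠ 0 := by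
    rw [hw.weightMeasure_apply Metric.isOpen_ball.measurableSet]
    simpa using hw.mass_ball_pos hwpos z (show (0 : ℝ) < 1 / n by positivity)
  have hkz : Measurable fun x => ENNReal.ofReal ((1 + n * dist x z) ^ β)⁻¹ :=
    hk.comp (measurable_id.prodMk measurable_const)
  rw [lintegral_mul_const _ (hkz.const_mul _), lintegral_const_mul _ hkz]
  calc _ ≤ ‖f z‖ₑ ^ q * (K * ν (Metric.ball z (1 / n))) * (ν (Metric.ball z (1 / n)))⁻¹ := by
        gcongr; exact hβ z
    _ = K * ‖f z‖ₑ ^ q * (ν (Metric.ball z (1 / n)) * (ν (Metric.ball z (1 / n)))⁻¹) := by ring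
    _ = _ := by rw [ENNReal.mul_inv_cancel h0 (measure_ne_top _ _), mul_one]

/-- The maximal inequality `‖f*‖_{q,w} ≤ K ‖f‖_{q,w}` for polynomials. -/
theorem exists_lintegral_decayMax_le {ι : Ω → EuclideanSpace ℝ (Fin d)} {a : ℝ → ℝ}
    (hϖ : IsDoublingWeight m ϖ) (hpos : 0 < ∫ x, ϖ x ∂m) (hι : Continuous ι) (ha : IsCutoff a)
    (h2 : Assertion2 ι m ϖ a) (h3 : Assertion3 m ϖ)
    (hw : IsDoublingWeight m w) (hwpos : 0 < ∫ x, w x ∂m) :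
    ∃ (β : ℕ) (K : ℝ), 0 < K ∧ ∀ n : ℕ, 1 ≤ n → ∀ f ∈ polysDeg ι n, ∀ q : ℝ, 1 ≤ q →
      ∫⁻ x, ENNReal.ofReal (decayMax n β f x) ^ q ∂(weightMeasure m w) ≤
        ENNReal.ofReal K ^ q * ∫⁻ x, ‖f x‖ₑ ^ q ∂(weightMeasure m w) := by
  obtain ⟨β, hβ⟩ := hw.exists_lintegral_decay_le
  obtain ⟨δ, hδ, hδ1, hball⟩ := exists_decayMax_mul_le_on_ball hϖ hpos hι ha h2 h3 β
  obtain ⟨C, hC, havg⟩ := hw.exists_rpow_le_lintegral hwpos β hδ hδ1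
  refine ⟨β, 2 * (C * (2 ^ β * 2)), by positivity, fun n hn f hf q hq => ?_⟩
  have hC0 : 0 < C := by linarith
  calc ∫⁻ x, ENNReal.ofReal (decayMax n β f x) ^ q ∂(weightMeasure m w)
      ≤ ∫⁻ x, ENNReal.ofReal (2 ^ q * C) *
        ∫⁻ z, ‖f z‖ₑ ^ q * ENNReal.ofReal ((1 + n * dist x z) ^ β)⁻¹ *
          (weightMeasure m w (Metric.ball z (1 / n)))⁻¹ ∂(weightMeasure m w)
          ∂(weightMeasure m w) := by
        refine lintegral_mono fun x => ?_
        obtain ⟨y, hy⟩ := hball n hn f hf x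
        exact havg n hn f _ (decayMax_nonneg _ _ _ _) x y hy q hq
    _ ≤ ENNReal.ofReal (2 ^ q * C) * (ENNReal.ofReal (2 ^ β * 2) *
          ∫⁻ x, ‖f x‖ₑ ^ q ∂(weightMeasure m w)) := by
        rw [lintegral_const_mul' _ _ ENNReal.ofReal_ne_top]
        gcongr
        exact lintegral_lintegral_decay_le hw hwpos hn (hβ n hn)
          (continuous_of_mem_polysDeg hι hf)
    _ ≤ _ := by
        rw [← mul_assoc, ← ENNReal.ofReal_mul (by positivity),
          ENNReal.ofReal_rpow_of_nonneg (by positivity) (by linarith),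
          Real.mul_rpow (by positivity) (by positivity), mul_assoc]
        gcongr
        -- Since `C (2^β · 2) ≥ 1`, it is at most its own `q`-th power, so one `K` serves all `q`.
        refine Real.self_le_rpow_of_one_le ?_ hq
        have : (1 : ℝ) ≤ 2 ^ β := one_le_pow₀ one_le_two
        nlinarith

end MaximalInequality
/-- The Bernstein inequality for `(-𝔇_ϖ)^{r/2}` on a compact domain. -/
theorem EigenOperator.exists_wNorm_fracPow_le [MetricSpace Ω] [CompactSpace Ω] [MeasurableSpace Ω]
    [BorelSpace Ω] {ι : Ω → EuclideanSpace ℝ (Fin d)} (hι : Continuous ι) {m : Measure Ω}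
    {ϖ w : Ω → ℝ} (hϖ : IsDoublingWeight m ϖ) (hpos : 0 < ∫ x, ϖ x ∂m)
    (D : EigenOperator ι m ϖ) {a : ℝ → ℝ} (ha : IsCutoff a) {r : ℝ}
    (h2 : Assertion2 ι m ϖ a) (h3 : Assertion3 m ϖ) (h5 : Assertion5 D a r)
    (hw : IsDoublingWeight m w) {p : ℝ≥0∞} (hp : 1 ≤ p) :
    ∃ c : ℝ, 0 < c ∧ ∀ n : ℕ, 1 ≤ n → ∀ f ∈ polysDeg ι n,
      wNorm m w p (D.fracPow r f) ≤ ENNReal.ofReal (c * (n : ℝ) ^ r) * wNorm m w p f := by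
  by_cases hp_top : p = ⊤
  -- With `β = 0` the maximal function is the uniform norm of `f`, attained by compactness.
  · obtain ⟨C, hC, h⟩ := D.exists_abs_fracPow_le hϖ hpos hι ha h3 h5 0
    refine ⟨C, hC, fun n hn f hf => ?_⟩
    simp only [wNorm, if_pos hp_top]
    refine iSup_le fun x => ?_
    obtain ⟨y, -, hy⟩ := isCompact_univ.exists_isMaxOn ⟨x, trivial⟩
      (continuous_of_mem_polysDeg hι hf).abs.continuousOn
    have hle : |D.fracPow r f x| ≤ C * (n : ℝ) ^ r * |f y| :=
      (h n hn f hf x).trans (mul_le_mul_of_nonneg_left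
        (decayMax_le (fun z => hy (Set.mem_univ z)) x) (by positivity))
    calc ‖D.fracPow r f x‖ₑ ≤ ENNReal.ofReal (C * (n : ℝ) ^ r) * ‖f y‖ₑ := by
          rw [Real.enorm_eq_ofReal_abs, Real.enorm_eq_ofReal_abs,
            ← ENNReal.ofReal_mul (by positivity)]
          exact ENNReal.ofReal_le_ofReal hle
      _ ≤ _ := by gcongr; exact le_iSup (fun z => ‖f z‖ₑ) y
  · simp only [wNorm, if_neg hp_top]
    change ∃ c : ℝ, 0 < c ∧ ∀ n : ℕ, 1 ≤ n → ∀ f ∈ polysDeg ι n,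
      eLpNorm (D.fracPow r f) p (weightMeasure m w) ≤
        ENNReal.ofReal (c * (n : ℝ) ^ r) * eLpNorm f p (weightMeasure m w)
    -- A doubling weight may have zero total mass; then both sides vanish.
    rcases (integral_nonneg hw.nonneg : 0 ≤ ∫ x, w x ∂m).eq_or_lt with h0 | hwpos
    · have hν : weightMeasure m w = 0 := by
        rw [← Measure.measure_univ_eq_zero, hw.weightMeasure_apply MeasurableSet.univ]
        simp [mass, ← h0]
      exact ⟨1, one_pos, fun n _ f _ => by simp [hν]⟩
    -- The weight `w` dictates `β`; the pointwise bound is available for every `β` and is taken at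
    -- this one.
    obtain ⟨β, K, hK, hmax⟩ := exists_lintegral_decayMax_le hϖ hpos hι ha h2 h3 hw hwpos
    obtain ⟨C, hC, h⟩ := D.exists_abs_fracPow_le hϖ hpos hι ha h3 h5 β
    refine ⟨C * K, by positivity, fun n hn f hf => ?_⟩
    have hp0 : p ≠ 0 := (zero_lt_one.trans_le hp).ne'
    have hq : 1 ≤ p.toReal := by
      simpa using ENNReal.toReal_mono hp_top hp
    have hq0 : 0 < p.toReal := by linarith
    rw [eLpNorm_eq_lintegral_rpow_enorm_toReal hp0 hp_top,
      eLpNorm_eq_lintegral_rpow_enorm_toReal hp0 hp_top, one_div,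
      ENNReal.rpow_inv_le_iff hq0, ENNReal.mul_rpow_of_nonneg _ _ hq0.le,
      ENNReal.rpow_inv_rpow hq0.ne']
    calc ∫⁻ x, ‖D.fracPow r f x‖ₑ ^ p.toReal ∂(weightMeasure m w)
        ≤ ∫⁻ x, ENNReal.ofReal (C * (n : ℝ) ^ r) ^ p.toReal *
            ENNReal.ofReal (decayMax n β f x) ^ p.toReal ∂(weightMeasure m w) := by
          refine lintegral_mono fun x => ?_
          rw [← ENNReal.mul_rpow_of_nonneg _ _ hq0.le, ← ENNReal.ofReal_mul (by positivity),
            Real.enorm_eq_ofReal_abs]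
          exact ENNReal.rpow_le_rpow (ENNReal.ofReal_le_ofReal (h n hn f hf x)) hq0.le
      _ ≤ ENNReal.ofReal (C * (n : ℝ) ^ r) ^ p.toReal * (ENNReal.ofReal K ^ p.toReal *
            ∫⁻ x, ‖f x‖ₑ ^ p.toReal ∂(weightMeasure m w)) := by
          rw [lintegral_const_mul' _ _ (ENNReal.rpow_ne_top_of_nonneg hq0.le ENNReal.ofReal_ne_top)]
          gcongr
          exact hmax n hn f hf _ hq
      _ = _ := by
          rw [← mul_assoc, ← ENNReal.mul_rpow_of_nonneg _ _ hq0.le,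
            ← ENNReal.ofReal_mul (by positivity)]
          ring_nf

end ConicBernstein
end

theorem mainTheorem11 {d : ℕ} {Ω : Type*} [MetricSpace Ω] [MeasurableSpace Ω] [BorelSpace Ω]
    (ι : Ω → EuclideanSpace ℝ (Fin d)) (hι : Topology.IsEmbedding ι)
    (m : Measure Ω) (hm : ConicBernstein.IsHomogeneous m)
    (ϖ : Ω → ℝ) (hϖ : ConicBernstein.IsDoublingWeight m ϖ) (hϖ_norm : ∫ x, ϖ x ∂m = 1)
    (D : ConicBernstein.EigenOperator ι m ϖ)
    (a : ℝ → ℝ) (ha : ConicBernstein.IsCutoff a)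
    (r : ℝ) (hr : 0 < r)
    (h1 : ConicBernstein.Assertion1 ι m ϖ a)
    (h2 : ConicBernstein.Assertion2 ι m ϖ a)
    (h3 : ConicBernstein.Assertion3 m ϖ)
    (h4 : ConicBernstein.Assertion4 ι)
    (h5 : ConicBernstein.Assertion5 D a r)
    (w : Ω → ℝ) (hw : ConicBernstein.IsDoublingWeight m w)
    (p : ℝ≥0∞) (hp : 1 ≤ p) :
    ∃ c : ℝ, 0 < c ∧ ∀ n : ℕ, 1 ≤ n → ∀ f ∈ ConicBernstein.polysDeg ι n,
      ConicBernstein.wNorm m w p (D.fracPow r f) ≤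
        ENNReal.ofReal (c * (n : ℝ) ^ r) * ConicBernstein.wNorm m w p f := by
  have := h4.1
  exact D.exists_wNorm_fracPow_le hι.continuous hϖ (hϖ_norm ▸ one_pos) ha h2 h3 h5 hw hp
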